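/- Let $\Omega\subset\mathbb{R}^3$ be a bounded Lipschitz domain (nonempty, open, connected, bounded, and locally at each boundary point, after a rigid motion, the region above the graph of a Lipschitz function). All functions and fields are real-valued; $(\cdot,\cdot)$ and $\|\cdot\|$ are the scalar product and norm of $L^2(\Omega)$. Let $H^1(\Omega)$, $H(\mathrm{rot};\Omega)$, $H(\mathrm{div};\Omega)$ be the spaces of $L^2$ functions resp. vector fields whose weak gradient, rotation resp. divergence is in $L^2(\Omega)$, and let $H^1_0(\Omega)$, $H_0(\mathrm{rot};\Omega)$, $H_0(\mathrm{div};\Omega)$ be the closures of the smooth functions resp. fields with compact support in $\Omega$ with respect to the graph norms. Let $\varepsilon:\Omega\to\mathbb{R}^{3\times3}$ be a measurable, symmetric, essentially bounded and uniformly positive definite matrix field, put $(E,F)_\varepsilon:=(\varepsilon E,F)$ and $\|E\|_\varepsilon:=(\varepsilon E,E)^{1/2}$, and let $\underline{\varepsilon},\overline{\varepsilon}>0$ be any numbers such that $$\underline{\varepsilon}^{-2}\|E\|^2\le(\varepsilon E,E)\le\overline{\varepsilon}^{2}\|E\|^2\qquad\text{for all vector fields }E\in L^2(\Omega).$$ Let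 $$\mathcal{H}_{D,\varepsilon}=\{W\in H_0(\mathrm{rot};\Omega):\ \varepsilon W\in H(\mathrm{div};\Omega),\ \mathrm{rot}\,W=0,\ \mathrm{div}\,\varepsilon W=0\},$$ $$\mathcal{H}_{N,\varepsilon}=\{W\in H(\mathrm{rot};\Omega):\ \varepsilon W\in H_0(\mathrm{div};\Omega),\ \mathrm{rot}\,W=0,\ \mathrm{div}\,\varepsilon W=0\}$$ be the spaces of Dirichlet and Neumann fields, and let $\pi_D,\pi_N$ be the $(\cdot,\cdot)_\varepsilon$-orthogonal projections of the $L^2$ vector fields onto them. Let $c_{p,\circ}$, $c_p$, $c_{m,t,\varepsilon}$, $c_{m,n,\varepsilon}$ be the smallest constants (in $[0,\infty]$) in the estimates $$\|u\|\le c_{p,\circ}\|\nabla u\|\quad\text{for all }u\in H^1_0(\Omega),\qquad \|u\|\le c_{p}\|\nabla u\|\quad\text{for all }u\in H^1(\Omega)\text{ with }\int_\Omega u=0,$$ $$\|E-\pi_DE\|_\varepsilon\le c_{m,t,\varepsilon}\big(\|\mathrm{rot}\,E\|^2+\|\mathrm{div}\,\varepsilon E\|^2\big)^{1/2}\quad\text{for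 all }E\in H_0(\mathrm{rot};\Omega)\text{ with }\varepsilon E\in H(\mathrm{div};\Omega),$$ $$\|H-\pi_NH\|_\varepsilon\le c_{m,n,\varepsilon}\big(\|\mathrm{rot}\,H\|^2+\|\mathrm{div}\,\varepsilon H\|^2\big)^{1/2}\quad\text{for all }H\in H(\mathrm{rot};\Omega)\text{ with }\varepsilon H\in H_0(\mathrm{div};\Omega).$$ Then $$\frac{c_{p,\circ}}{\underline{\varepsilon}\,\overline{\varepsilon}^{2}}\le c_{m,t,\varepsilon}\qquad\text{and}\qquad\frac{c_{p}}{\underline{\varepsilon}\,\overline{\varepsilon}^{2}}\le c_{m,n,\varepsilon}.$$ -/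

import Mathlib

open MeasureTheory Set
open scoped NNReal ENNReal Matrix Distributions

namespace Maxwell

/-! ## Domains and Lebesgue spaces -/

/-- Three-dimensional Euclidean space. -/
abbrev R3 : Type := EuclideanSpace ℝ (Fin 3)

/-- A bounded Lipschitz domain of `ℝ³`: a nonempty, connected, bounded open set which near each of
its boundary points is, after a rigid motion, the set of points above the graph of a Lipschitz
function of two variables. -/
structure IsBoundedLipschitzDomain (Ω : TopologicalSpace.Opens R3) : Prop where
  connected : IsConnected (Ω : Set R3)
  bounded : Bornology.IsBounded (Ω : Set R3)
  lipschitz : ∀ z ∈ frontier (Ω : Set R3), ∃ U : Set R3, IsOpen U ∧ z ∈ U ∧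
    ∃ (T : R3 ≃ᵢ R3) (K : ℝ≥0) (γ : EuclideanSpace ℝ (Fin 2) → ℝ), LipschitzWith K γ ∧
      ∀ y ∈ U, y ∈ Ω ↔ γ (!₂[T y 0, T y 1]) < T y 2

/-- Lebesgue measure on `Ω`. -/
noncomputable abbrev vol (Ω : TopologicalSpace.Opens R3) : Measure R3 :=
  volume.restrict (Ω : Set R3)

/-- Real-valued square integrable functions on `Ω`. -/
abbrev L2 (Ω : TopologicalSpace.Opens R3) : Type := Lp ℝ 2 (vol Ω)

/-- Square integrable (real) vector fields on `Ω`. -/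
abbrev L2v (Ω : TopologicalSpace.Opens R3) : Type := Lp R3 2 (vol Ω)

/-! ## Classical differential operators on smooth functions and fields -/

/-- The partial derivative `∂ⱼ Φᵢ` of a vector field. -/
noncomputable def pd (j i : Fin 3) (Φ : R3 → R3) (x : R3) : ℝ :=
  fderiv ℝ Φ x (EuclideanSpace.single j 1) i

/-- The divergence of a differentiable vector field. -/
noncomputable def cdiv (Φ : R3 → R3) (x : R3) : ℝ :=
  ∑ i, pd i i Φ x

/-- The rotation of a differentiable vector field. -/
noncomputable def crot (Φ : R3 → R3) (x : R3) : R3 :=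
  !₂[pd 1 2 Φ x - pd 2 1 Φ x, pd 2 0 Φ x - pd 0 2 Φ x, pd 0 1 Φ x - pd 1 0 Φ x]

/-! ## Weak derivatives and the Sobolev spaces -/

section Sobolev

variable (Ω : TopologicalSpace.Opens R3)

/-- `u ∈ H¹(Ω)` and `∇u = G`. -/
def HasGrad (u : L2 Ω) (G : L2v Ω) : Prop :=
  ∀ Φ : 𝓓(Ω, R3), ∫ x in Ω, inner ℝ (G x) (Φ x) = -∫ x in Ω, u x * cdiv Φ x

/-- `E ∈ H(rot; Ω)` and `rot E = R`. -/
def HasRot (E R : L2v Ω) : Prop :=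
  ∀ Φ : 𝓓(Ω, R3), ∫ x in Ω, inner ℝ (R x) (Φ x) = ∫ x in Ω, inner ℝ (E x) (crot Φ x)

/-- `E ∈ H(div; Ω)` and `div E = f`. -/
def HasDiv (E : L2v Ω) (f : L2 Ω) : Prop :=
  ∀ φ : 𝓓(Ω, ℝ), ∫ x in Ω, f x * φ x = -∫ x in Ω, inner ℝ (E x) (gradient φ x)

/-- `u` belongs to the closure of the test functions in `H¹(Ω)`, and `∇u = G`. The closure of pairs
in the product is the closure in the graph norm. -/
def HasGrad₀ (u : L2 Ω) (G : L2v Ω) : Prop :=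
  HasGrad Ω u G ∧ (u, G) ∈ closure {p : L2 Ω × L2v Ω |
    ∃ φ : 𝓓(Ω, ℝ), p.1 =ᵐ[vol Ω] φ ∧ p.2 =ᵐ[vol Ω] gradient φ}

/-- `E` belongs to the closure of the test fields in `H(rot; Ω)`, and `rot E = R`. -/
def HasRot₀ (E R : L2v Ω) : Prop :=
  HasRot Ω E R ∧ (E, R) ∈ closure {p : L2v Ω × L2v Ω |
    ∃ Φ : 𝓓(Ω, R3), p.1 =ᵐ[vol Ω] Φ ∧ p.2 =ᵐ[vol Ω] crot Φ}

/-- `E` belongs to the closure of the test fields in `H(div; Ω)`, and `div E = f`. -/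
def HasDiv₀ (E : L2v Ω) (f : L2 Ω) : Prop :=
  HasDiv Ω E f ∧ (E, f) ∈ closure {p : L2v Ω × L2 Ω |
    ∃ Φ : 𝓓(Ω, R3), p.1 =ᵐ[vol Ω] Φ ∧ p.2 =ᵐ[vol Ω] cdiv Φ}

end Sobolev

/-! ## The matrix field `ε` -/

/-- A measurable, symmetric, essentially bounded and uniformly positive definite matrix field
on `Ω`. -/
structure Medium (Ω : TopologicalSpace.Opens R3) where
  mat : R3 → Matrix (Fin 3) (Fin 3) ℝ
  aemeasurable : ∀ i j, AEMeasurable (fun x => mat x i j) (vol Ω)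
  symmetric : ∀ᵐ x ∂(vol Ω), (mat x).IsSymm
  bounded : ∃ M : ℝ, ∀ᵐ x ∂(vol Ω), ∀ i j, |mat x i j| ≤ M
  positive : ∃ α : ℝ, 0 < α ∧ ∀ᵐ x ∂(vol Ω), ∀ ξ : Fin 3 → ℝ, α * (ξ ⬝ᵥ ξ) ≤ ξ ⬝ᵥ (mat x *ᵥ ξ)

namespace Medium

variable {Ω : TopologicalSpace.Opens R3} (ε : Medium Ω)

theorem memLp_mul (E : L2v Ω) :
    MemLp (fun x => WithLp.toLp 2 (ε.mat x *ᵥ (E x).ofLp) : R3 → R3) 2 (vol Ω) := by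
  obtain ⟨M, hM⟩ := ε.bounded
  have hE : ∀ j, MemLp (fun x => E x j) 2 (vol Ω) := memLp_piLp_iff.1 (Lp.memLp E)
  refine memLp_piLp_iff.2 fun i => ?_
  have key : MemLp (fun x => ∑ j, ε.mat x i j * E x j) 2 (vol Ω) := by
    refine memLp_finsetSum _ fun j _ => ?_
    refine MemLp.of_le_mul (c := M) (hE j)
      ((ε.aemeasurable i j).aestronglyMeasurable.mul (hE j).1) ?_
    filter_upwards [hM] with x hx
    rw [norm_mul]
    exact mul_le_mul_of_nonneg_right (hx i j) (norm_nonneg _)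
  exact key

/-- The field `ε E`. -/
noncomputable def mul (E : L2v Ω) : L2v Ω := (ε.memLp_mul E).toLp _

/-- The weighted scalar product `(E, F)_ε = (ε E, F)` of `L²(Ω)`. -/
noncomputable def scp (E F : L2v Ω) : ℝ := inner ℝ (ε.mul E) F

/-- The weighted norm `‖E‖_ε = (ε E, E)^{1/2}`. -/
noncomputable def wnorm (E : L2v Ω) : ℝ := Real.sqrt (ε.scp E E)

/-- `W` is a Dirichlet field: `W ∈ H₀(rot; Ω)`, `rot W = 0`, `ε W ∈ H(div; Ω)`, `div ε W = 0`. -/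
def IsDirichletField (W : L2v Ω) : Prop :=
  HasRot₀ Ω W 0 ∧ HasDiv Ω (ε.mul W) 0

/-- `W` is a Neumann field: `W ∈ H(rot; Ω)`, `rot W = 0`, `ε W ∈ H₀(div; Ω)`, `div ε W = 0`. -/
def IsNeumannField (W : L2v Ω) : Prop :=
  HasRot Ω W 0 ∧ HasDiv₀ Ω (ε.mul W) 0

/-- `P` is the `ε`-orthogonal projection of `E` onto the space of fields satisfying `K`. -/
def IsProj (K : L2v Ω → Prop) (E P : L2v Ω) : Prop :=
  K P ∧ ∀ W, K W → ε.scp (E - P) W = 0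

end Medium

/-! ## The constants

Each constant is the best (smallest) one in the estimate that defines it, as an element of `[0, ∞]`
which is `∞` if the estimate holds with no finite constant. -/

/-- The best constant in `‖u‖ ≤ c ‖∇u‖` for `u ∈ H¹₀(Ω)`. -/
noncomputable def poincareConstDirichlet (Ω : TopologicalSpace.Opens R3) : ℝ≥0∞ :=
  sInf {c : ℝ≥0∞ | ∃ c' : ℝ≥0, c = c' ∧
    ∀ (u : L2 Ω) (G : L2v Ω), HasGrad₀ Ω u G → ‖u‖ ≤ c' * ‖G‖}

/-- The best constant in `‖u‖ ≤ c ‖∇u‖` for `u ∈ H¹(Ω)` with `∫ u = 0`. -/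
noncomputable def poincareConst (Ω : TopologicalSpace.Opens R3) : ℝ≥0∞ :=
  sInf {c : ℝ≥0∞ | ∃ c' : ℝ≥0, c = c' ∧
    ∀ (u : L2 Ω) (G : L2v Ω), HasGrad Ω u G → ∫ x in Ω, u x = 0 → ‖u‖ ≤ c' * ‖G‖}

/-- The best constant in `‖E - P‖_ε ≤ c (‖rot E‖² + ‖div ε E‖²)^{1/2}` for all fields
`E ∈ H₀(rot; Ω) ∩ ε⁻¹ H(div; Ω)`, where `P` is the projection of `E` onto the Dirichlet fields. -/
noncomputable def maxwellConstTangential {Ω : TopologicalSpace.Opens R3} (ε : Medium Ω) : ℝ≥0∞ :=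
  sInf {c : ℝ≥0∞ | ∃ c' : ℝ≥0, c = c' ∧
    ∀ (E R P : L2v Ω) (f : L2 Ω), HasRot₀ Ω E R → HasDiv Ω (ε.mul E) f →
      ε.IsProj ε.IsDirichletField E P → ε.wnorm (E - P) ≤ c' * Real.sqrt (‖R‖ ^ 2 + ‖f‖ ^ 2)}

/-- The best constant in `‖H - P‖_ε ≤ c (‖rot H‖² + ‖div ε H‖²)^{1/2}` for all fields
`H ∈ H(rot; Ω) ∩ ε⁻¹ H₀(div; Ω)`, where `P` is the projection of `H` onto the Neumann fields. -/
noncomputable def maxwellConstNormal {Ω : TopologicalSpace.Opens R3} (ε : Medium Ω) : ℝ≥0∞ :=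
  sInf {c : ℝ≥0∞ | ∃ c' : ℝ≥0, c = c' ∧
    ∀ (H R P : L2v Ω) (f : L2 Ω), HasRot Ω H R → HasDiv₀ Ω (ε.mul H) f →
      ε.IsProj ε.IsNeumannField H P → ε.wnorm (H - P) ≤ c' * Real.sqrt (‖R‖ ^ 2 + ‖f‖ ^ 2)}

end Maxwell

/-! The Poincaré estimate for the gradient is dual to the Maxwell estimate restricted to limits of
gradients. Let `Γ` be the graph of the closed gradient `A`, on $H^1_0$ or on $H^1$, and let $E$ lie
in the closure of its range, with $\varepsilon E$ in the domain of $A^*=-\mathrm{div}$ (boundary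
conditions being exchanged). Then $\mathrm{rot}\,E=0$. Moreover $E$ is $\varepsilon$-orthogonal to
the Dirichlet resp. Neumann fields $W$, because $\varepsilon W$ lies in the kernel of $A^*$. So the
projection of $E$ vanishes and the Maxwell estimate reads $\|E\|_\varepsilon\le
c\,\|\mathrm{div}\,\varepsilon E\|$.

This is dualized in `norm_le_of_adjoint_estimate`. The functions $f=\mathrm{div}\,\varepsilon E$
obtained from such $E$ are dense in the orthogonal complement of $\ker A$, by Lax–Milgram and
Hahn–Banach; neither compactness nor closed range is needed. For $u\perp\ker A$,
$|(f,u)|=|(\varepsilon E,\nabla u)|\le\|E\|_\varepsilon\|\nabla u\|_\varepsilon\le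
c\,\overline\varepsilon\,\|f\|\,\|\nabla u\|$, and letting $f\to u$ gives $\|u\|\le
c\,\overline\varepsilon\,\|\nabla u\|$. This is at least as strong as the claim, since
$\underline\varepsilon\,\overline\varepsilon\ge1$.

It remains to identify the kernels: zero for $H^1_0$ (`HasGrad₀.eq_zero`, by Friedrichs) and only
constants for $H^1$ (`HasGrad.ae_eq_const`, by mollification and connectedness). -/

/-! ## A closed linear relation and the adjoint estimate -/

section Hilbert

open scoped RealInnerProductSpace

variable {X Y : Type*} [NormedAddCommGroup X] [InnerProductSpace ℝ X] [CompleteSpace X]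
  [NormedAddCommGroup Y] [InnerProductSpace ℝ Y] [CompleteSpace Y]

/-- A point of a product of Hilbert spaces lies in the closure of a subspace as soon as it is
orthogonal to everything orthogonal to the subspace. -/
theorem Submodule.mem_closure_prod_of_forall_orthogonal (S : Submodule ℝ (X × Y)) (p : X × Y)
    (h : ∀ (a : X) (b : Y), (∀ s ∈ S, ⟪a, s.1⟫ + ⟪b, s.2⟫ = 0) → ⟪a, p.1⟫ + ⟪b, p.2⟫ = 0) :
    p ∈ closure (S : Set (X × Y)) := by
  by_contra hp
  obtain ⟨l, c, hl, hc⟩ := geometric_hahn_banach_closed_point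
    (S.convex.closure) isClosed_closure hp
  have hlS : ∀ s ∈ S, l s = 0 := by
    intro s hs
    by_contra hne
    -- A functional bounded above on a subspace vanishes there: if `l s ≠ 0`, this multiple of `s`
    -- would attain the strict bound `c`.
    have := hl ((c / l s) • s) (subset_closure (S.smul_mem _ hs))
    rw [map_smul, smul_eq_mul, div_mul_cancel₀ _ hne] at this
    exact lt_irrefl _ this
  have h0 : 0 < c := by simpa using hl 0 (subset_closure S.zero_mem)
  have key : ∀ s : X × Y, l s =
      ⟪(InnerProductSpace.toDual ℝ X).symm (l.comp (ContinuousLinearMap.inl ℝ X Y)), s.1⟫ +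
      ⟪(InnerProductSpace.toDual ℝ Y).symm (l.comp (ContinuousLinearMap.inr ℝ X Y)), s.2⟫ := by
    intro s
    rw [InnerProductSpace.toDual_symm_apply, InnerProductSpace.toDual_symm_apply]
    simp only [ContinuousLinearMap.comp_apply, ContinuousLinearMap.inl_apply,
      ContinuousLinearMap.inr_apply, ← map_add]
    simp
  have := h _ _ fun s hs => (key s).symm.trans (hlS s hs)
  rw [← key] at this
  linarith

/-- Lax–Milgram on a closed subspace. -/
theorem exists_mem_inner_eq_of_coercive (M : Y →L[ℝ] Y) {α : ℝ} (hα : 0 < α)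
    (hM : ∀ E, α * ‖E‖ ^ 2 ≤ ⟪M E, E⟫) (V : Submodule ℝ Y) (hV : IsClosed (V : Set Y)) (F : Y) :
    ∃ E ∈ V, ∀ G ∈ V, ⟪M E, G⟫ = ⟪F, G⟫ := by
  have : CompleteSpace V := hV.completeSpace_coe
  let B : V →L[ℝ] V →L[ℝ] ℝ :=
    ((innerSL ℝ (E := V)).comp (V.orthogonalProjectionOnto.comp (M.comp V.subtypeL)))
  have hB : ∀ E G : V, B E G = ⟪M E, (G : Y)⟫ := fun E G => by
    simp [B]
  have hc : IsCoercive B := ⟨α, hα, fun E => by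
    rw [hB, mul_assoc, ← sq]; exact hM E⟩
  refine ⟨hc.continuousLinearEquivOfBilin.symm (V.orthogonalProjectionOnto F), Subtype.prop _, ?_⟩
  intro G hG
  have := hc.continuousLinearEquivOfBilin_apply
    (hc.continuousLinearEquivOfBilin.symm (V.orthogonalProjectionOnto F)) ⟨G, hG⟩
  rw [hB, ContinuousLinearEquiv.apply_symm_apply] at this
  simpa using this.symm

/-- Cauchy–Schwarz for a symmetric nonnegative operator. -/
theorem abs_inner_le_sqrt_mul_sqrt {Y : Type*} [NormedAddCommGroup Y] [InnerProductSpace ℝ Y]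
    (M : Y →ₗ[ℝ] Y) (hs : ∀ E F, ⟪M E, F⟫ = ⟪E, M F⟫)
    (h0 : ∀ E, 0 ≤ ⟪M E, E⟫) (E F : Y) : |⟪M E, F⟫| ≤ √⟪M E, E⟫ * √⟪M F, F⟫ := by
  let B : LinearMap.BilinForm ℝ Y := (innerₗ Y).comp M
  have hB : LinearMap.IsSymm B := ⟨fun E F => by
    change ⟪M E, F⟫ = ⟪M F, E⟫
    rw [hs, real_inner_comm]⟩
  have := B.apply_sq_le_of_symm (fun E => h0 E) hB E F
  rw [← Real.sqrt_mul (h0 E)]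
  exact Real.abs_le_sqrt this

/-- Let `Γ` be a closed linear relation (the graph of `A`). If every `E` in the closure of the
range of `A` satisfies `⟪M E, E⟫ ^ (1/2) ≤ c ‖f‖` whenever `-f` is the adjoint `A*` at `M E`, then
`‖u‖ ≤ c b ‖A u‖` for every `u` in the domain of `A` which is orthogonal to its kernel, where `b²` is
an upper bound of `M`. -/
theorem norm_le_of_adjoint_estimate (M : Y →L[ℝ] Y) (hs : ∀ E F, ⟪M E, F⟫ = ⟪E, M F⟫)
    {α : ℝ} (hα : 0 < α) (hM : ∀ E, α * ‖E‖ ^ 2 ≤ ⟪M E, E⟫)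
    {b : ℝ} (hb : 0 ≤ b) (hMb : ∀ E, ⟪M E, E⟫ ≤ b ^ 2 * ‖E‖ ^ 2)
    (Γ : Submodule ℝ (X × Y)) (hΓ : IsClosed (Γ : Set (X × Y))) {c : ℝ} (hc : 0 ≤ c)
    (hest : ∀ E ∈ (Γ.map (LinearMap.snd ℝ X Y)).topologicalClosure, ∀ f : X,
      (∀ p ∈ Γ, ⟪M E, p.2⟫ = -⟪f, p.1⟫) → √⟪M E, E⟫ ≤ c * ‖f‖)
    {u : X} {G : Y} (hu : (u, G) ∈ Γ) (hker : ∀ v, (v, (0 : Y)) ∈ Γ → ⟪v, u⟫ = 0) :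
    ‖u‖ ≤ c * b * ‖G‖ := by
  set V := (Γ.map (LinearMap.snd ℝ X Y)).topologicalClosure with hVdef
  have hmemV : ∀ p ∈ Γ, p.2 ∈ V := fun p hp =>
    Submodule.le_topologicalClosure _ (Submodule.mem_map_of_mem (f := LinearMap.snd ℝ X Y) hp)
  -- All right-hand sides `f` to which `hest` applies, that is, the range of $-A^*M$ on `V`.
  let N : Submodule ℝ X :=
    { carrier := {f | ∃ E ∈ V, ∀ p ∈ Γ, ⟪M E, p.2⟫ = -⟪f, p.1⟫}
      add_mem' := by
        rintro f g ⟨E, hE, hf⟩ ⟨F, hF, hg⟩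
        refine ⟨E + F, V.add_mem hE hF, fun p hp => ?_⟩
        rw [map_add, inner_add_left, inner_add_left, hf p hp, hg p hp]; ring
      zero_mem' := ⟨0, V.zero_mem, fun p _ => by simp⟩
      smul_mem' := by
        rintro r f ⟨E, hE, hf⟩
        refine ⟨r • E, V.smul_mem r hE, fun p hp => ?_⟩
        rw [map_smul, real_inner_smul_left, real_inner_smul_left, hf p hp]; ring }
  -- If `(a, F)` annihilates `Γ`, Lax–Milgram replaces `F` by `M E` with `E ∈ V` without changing
  -- its pairing with the range of $A$. Hence `a ∈ N`, so `v ⊥ a`, and `(v, 0)` lies in the closed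
  -- subspace `Γ`.
  have hN : ∀ v ∈ Nᗮ, (v, (0 : Y)) ∈ Γ := by
    intro v hv
    have : (v, (0 : Y)) ∈ closure (Γ : Set (X × Y)) := by
      refine Γ.mem_closure_prod_of_forall_orthogonal _ fun a F h => ?_
      obtain ⟨E, hE, hEF⟩ := exists_mem_inner_eq_of_coercive M hα hM V
        (Submodule.isClosed_topologicalClosure _) F
      have haN : a ∈ N := ⟨E, hE, fun p hp => by
        rw [hEF _ (hmemV p hp)]; linarith [h p hp]⟩
      simpa using hv a haN
    rwa [hΓ.closure_eq] at this
  have huN : u ∈ N.topologicalClosure := by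
    rw [← Submodule.orthogonal_orthogonal_eq_closure]
    exact fun v hv => hker v (hN v hv)
  have hpos : ∀ E, 0 ≤ ⟪M E, E⟫ := fun E => le_trans (by positivity) (hM E)
  have hbound : ∀ f ∈ N, ⟪f, u⟫ ≤ c * b * ‖G‖ * ‖f‖ := by
    rintro f ⟨E, hE, hf⟩
    have h1 : ⟪f, u⟫ = -⟪M E, G⟫ := by rw [hf _ hu]; ring
    have h2 := abs_inner_le_sqrt_mul_sqrt M.toLinearMap hs hpos E G
    have h3 : √⟪M G, G⟫ ≤ b * ‖G‖ := by
      rw [← Real.sqrt_sq (mul_nonneg hb (norm_nonneg G)), mul_pow]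
      exact Real.sqrt_le_sqrt (hMb G)
    calc ⟪f, u⟫ ≤ |⟪M E, G⟫| := h1 ▸ neg_le_abs _
      _ ≤ √⟪M E, E⟫ * √⟪M G, G⟫ := h2
      _ ≤ (c * ‖f‖) * (b * ‖G‖) :=
        mul_le_mul (hest E hE f hf) h3 (Real.sqrt_nonneg _)
          ((Real.sqrt_nonneg _).trans (hest E hE f hf))
      _ = c * b * ‖G‖ * ‖f‖ := by ring
  -- `u` is only a limit of elements of `N`, so the bound is extended to the closure before being
  -- tested with `f = u`.
  have hcl : ∀ f ∈ N.topologicalClosure, ⟪f, u⟫ ≤ c * b * ‖G‖ * ‖f‖ := by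
    have hc : IsClosed {f : X | ⟪f, u⟫ ≤ c * b * ‖G‖ * ‖f‖} :=
      isClosed_le (by fun_prop) (by fun_prop)
    exact fun f hf => closure_minimal (fun f hf => hbound f hf) hc hf
  rcases eq_or_ne u 0 with rfl | hne
  · rw [norm_zero]; positivity
  · have := hcl u huN
    rw [real_inner_self_eq_norm_sq, sq] at this
    exact le_of_mul_le_mul_right this (norm_pos_iff.2 hne)

end Hilbert

namespace Maxwell

variable {Ω : TopologicalSpace.Opens R3}

/-! ## Calculus of test functions and test fields -/

/-- The `j`-th standard unit vector. -/
noncomputable abbrev unitVec (j : Fin 3) : R3 := EuclideanSpace.single j 1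

/-- The `j`-th partial derivative of a scalar function. -/
noncomputable def partialD (j : Fin 3) (f : R3 → ℝ) (x : R3) : ℝ := fderiv ℝ f x (unitVec j)

theorem gradient_apply (φ : R3 → ℝ) (x : R3) (i : Fin 3) :
    gradient φ x i = partialD i φ x := by
  have h : inner ℝ (gradient φ x) (unitVec i) = fderiv ℝ φ x (unitVec i) :=
    InnerProductSpace.toDual_symm_apply
  rw [partialD, ← h, EuclideanSpace.inner_single_right]
  simp

theorem contDiff_coord {Φ : R3 → R3} {n : WithTop ℕ∞} (hΦ : ContDiff ℝ n Φ) (i : Fin 3) :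
    ContDiff ℝ n fun x => Φ x i :=
  (contDiff_euclidean.1 hΦ) i

theorem pd_eq_partialD {Φ : R3 → R3} (hΦ : Differentiable ℝ Φ) (j i : Fin 3) (x : R3) :
    pd j i Φ x = partialD j (fun y => Φ y i) x := by
  have h := (((EuclideanSpace.proj i : R3 →L[ℝ] ℝ)).hasFDerivAt.comp x
    (hΦ x).hasFDerivAt).fderiv
  rw [partialD]
  change _ = fderiv ℝ ((EuclideanSpace.proj i : R3 →L[ℝ] ℝ) ∘ Φ) x _
  rw [h]; rfl

theorem contDiff_partialD {f : R3 → ℝ} (hf : ContDiff ℝ (⊤ : ℕ∞) f) (j : Fin 3) :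
    ContDiff ℝ (⊤ : ℕ∞) (partialD j f) :=
  (hf.fderiv_right (m := (⊤ : ℕ∞)) (by simp)).clm_apply contDiff_const

theorem partialD_comm {f : R3 → ℝ} (hf : ContDiff ℝ (⊤ : ℕ∞) f) (i j : Fin 3) (x : R3) :
    partialD i (partialD j f) x = partialD j (partialD i f) x := by
  have hd : DifferentiableAt ℝ (fderiv ℝ f) x :=
    ((hf.fderiv_right (m := (⊤ : ℕ∞)) (by simp)).differentiable (by simp)) x
  have h : ∀ v w : R3, fderiv ℝ (fun y => fderiv ℝ f y v) x w = fderiv ℝ (fderiv ℝ f) x w v := by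
    intro v w
    rw [fderiv_clm_apply hd (differentiableAt_const v)]
    simp
  have hs : IsSymmSndFDerivAt ℝ f x :=
    hf.contDiffAt.isSymmSndFDerivAt (by
      simpa using WithTop.coe_le_coe.2 (le_top : (2 : ℕ∞) ≤ ⊤))
  change fderiv ℝ (fun y => fderiv ℝ f y _) x _ = fderiv ℝ (fun y => fderiv ℝ f y _) x _
  rw [h, h]
  exact hs _ _

theorem tsupport_partialD_subset (j : Fin 3) (f : R3 → ℝ) :
    tsupport (partialD j f) ⊆ tsupport f :=
  closure_minimal (fun x hx => support_fderiv_subset ℝ fun h => hx (by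
    simp [partialD, h])) (isClosed_tsupport f)

theorem tsupport_coord_subset (Φ : R3 → R3) (i : Fin 3) :
    tsupport (fun x => Φ x i) ⊆ tsupport Φ :=
  closure_mono fun x hx h => hx (by simp [h])

/-- A test field given by its components. -/
noncomputable def testField (f : Fin 3 → 𝓓(Ω, ℝ)) : 𝓓(Ω, R3) where
  toFun x := WithLp.toLp 2 fun i => f i x
  contDiff' := contDiff_euclidean.2 fun i => (f i).contDiff
  hasCompactSupport' := by
    refine HasCompactSupport.intro
      (K := ⋃ i, tsupport (f i)) (isCompact_iUnion fun i => (f i).hasCompactSupport) ?_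
    intro x hx
    ext i
    exact image_eq_zero_of_notMem_tsupport (f := f i) fun h => hx (mem_iUnion.2 ⟨i, h⟩)
  tsupport_subset' := by
    refine (closure_minimal (t := ⋃ i, tsupport (f i)) ?_
      (isClosed_iUnion_of_finite fun i => isClosed_tsupport _)).trans
      (iUnion_subset fun i => (f i).tsupport_subset)
    intro x hx
    by_contra h
    refine hx ?_
    ext i
    exact image_eq_zero_of_notMem_tsupport (f := f i) fun h' => h (mem_iUnion.2 ⟨i, h'⟩)

/-- A component of a test field. -/
noncomputable def testCoord (Φ : 𝓓(Ω, R3)) (i : Fin 3) : 𝓓(Ω, ℝ) where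
  toFun x := Φ x i
  contDiff' := contDiff_coord Φ.contDiff i
  hasCompactSupport' := Φ.hasCompactSupport.of_isClosed_subset (isClosed_tsupport _)
    (tsupport_coord_subset Φ i)
  tsupport_subset' := (tsupport_coord_subset Φ i).trans Φ.tsupport_subset

/-- A partial derivative of a test function. -/
noncomputable def testPartial (j : Fin 3) (φ : 𝓓(Ω, ℝ)) : 𝓓(Ω, ℝ) where
  toFun := partialD j φ
  contDiff' := contDiff_partialD φ.contDiff j
  hasCompactSupport' := φ.hasCompactSupport.of_isClosed_subset (isClosed_tsupport _)
    (tsupport_partialD_subset j φ)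
  tsupport_subset' := (tsupport_partialD_subset j φ).trans φ.tsupport_subset

theorem testPartial_comm (i j : Fin 3) (φ : 𝓓(Ω, ℝ)) :
    testPartial i (testPartial j φ) = testPartial j (testPartial i φ) :=
  TestFunction.ext fun x => partialD_comm φ.contDiff i j x

theorem testPartial_sub (j : Fin 3) (φ ψ : 𝓓(Ω, ℝ)) :
    testPartial j (φ - ψ) = testPartial j φ - testPartial j ψ := by
  ext x
  change partialD j (fun y => φ y - ψ y) x = partialD j φ x - partialD j ψ x
  have h := fderiv_fun_sub (𝕜 := ℝ) (f := φ) (g := ψ) (x := x)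
    (φ.contDiff.differentiable (by simp) x) (ψ.contDiff.differentiable (by simp) x)
  simp only [partialD, h]
  rfl

/-- The gradient of a test function. -/
noncomputable def testGrad (φ : 𝓓(Ω, ℝ)) : 𝓓(Ω, R3) := testField fun i => testPartial i φ

theorem coe_testGrad (φ : 𝓓(Ω, ℝ)) : ⇑(testGrad φ) = gradient φ := by
  ext x i
  exact (gradient_apply φ x i).symm

theorem pd_test (Φ : 𝓓(Ω, R3)) (j i : Fin 3) (x : R3) :
    pd j i Φ x = testPartial j (testCoord Φ i) x :=
  pd_eq_partialD (Φ.contDiff.differentiable (by simp)) j i x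

/-- The divergence of a test field. -/
noncomputable def testDiv (Φ : 𝓓(Ω, R3)) : 𝓓(Ω, ℝ) :=
  testPartial 0 (testCoord Φ 0) + testPartial 1 (testCoord Φ 1) + testPartial 2 (testCoord Φ 2)

theorem coe_testDiv (Φ : 𝓓(Ω, R3)) : ⇑(testDiv Φ) = cdiv Φ := by
  ext x
  simp only [cdiv, Fin.sum_univ_three, pd_test]
  rfl

/-- The rotation of a test field. -/
noncomputable def testRot (Φ : 𝓓(Ω, R3)) : 𝓓(Ω, R3) :=
  testField ![testPartial 1 (testCoord Φ 2) - testPartial 2 (testCoord Φ 1),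
    testPartial 2 (testCoord Φ 0) - testPartial 0 (testCoord Φ 2),
    testPartial 0 (testCoord Φ 1) - testPartial 1 (testCoord Φ 0)]

theorem coe_testRot (Φ : 𝓓(Ω, R3)) : ⇑(testRot Φ) = crot Φ := by
  ext x i
  simp only [crot, pd_test]
  fin_cases i <;> rfl

/-- Symmetry of second derivatives. This puts limits of test gradients into $H_0(\mathrm{rot})$ with
zero rotation. -/
theorem crot_gradient (φ : 𝓓(Ω, ℝ)) : crot (gradient φ) = 0 := by
  rw [← coe_testGrad]
  have h : ∀ i j x, pd i j (testGrad φ) x = pd j i (testGrad φ) x := by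
    intro i j x
    rw [pd_test, pd_test]
    exact DFunLike.congr_fun (testPartial_comm i j φ) x
  ext x i
  simp only [crot]
  rw [h 1 2, h 2 0, h 0 1]
  fin_cases i <;> simp

/-- Mixed derivatives cancel in pairs. Tested against a weak gradient, this makes its weak rotation
vanish. -/
theorem cdiv_crot (Φ : 𝓓(Ω, R3)) : cdiv (crot Φ) = 0 := by
  rw [← coe_testRot, ← coe_testDiv]
  have h : testDiv (testRot Φ) = 0 := by
    change testPartial 0 (testPartial 1 (testCoord Φ 2) - testPartial 2 (testCoord Φ 1)) +
      testPartial 1 (testPartial 2 (testCoord Φ 0) - testPartial 0 (testCoord Φ 2)) +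
      testPartial 2 (testPartial 0 (testCoord Φ 1) - testPartial 1 (testCoord Φ 0)) = 0
    simp only [testPartial_sub]
    rw [testPartial_comm 1 0, testPartial_comm 2 0, testPartial_comm 2 1]
    abel
  rw [h]; rfl

/-! ## Test functions as elements of the Lebesgue spaces -/

theorem memLp_test {F : Type*} [NormedAddCommGroup F] [NormedSpace ℝ F] (φ : 𝓓(Ω, F)) :
    MemLp φ 2 (vol Ω) :=
  φ.continuous.memLp_of_hasCompactSupport φ.hasCompactSupport

/-- A test function as a square integrable function. -/
noncomputable def testLp {F : Type*} [NormedAddCommGroup F] [NormedSpace ℝ F] (φ : 𝓓(Ω, F)) :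
    Lp F 2 (vol Ω) := (memLp_test φ).toLp φ

theorem coeFn_testLp {F : Type*} [NormedAddCommGroup F] [NormedSpace ℝ F] (φ : 𝓓(Ω, F)) :
    testLp φ =ᵐ[vol Ω] φ := MemLp.coeFn_toLp _

theorem eq_testLp {F : Type*} [NormedAddCommGroup F] [NormedSpace ℝ F] {φ : 𝓓(Ω, F)}
    {f : Lp F 2 (vol Ω)} (h : f =ᵐ[vol Ω] φ) : f = testLp φ :=
  Lp.ext (h.trans (coeFn_testLp φ).symm)

theorem integral_inner_test (G : L2v Ω) (Φ : 𝓓(Ω, R3)) :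
    ∫ x in Ω, inner ℝ (G x) (Φ x) = inner ℝ G (testLp Φ) := by
  rw [L2.inner_def]
  refine integral_congr_ae ?_
  filter_upwards [coeFn_testLp Φ] with x hx
  rw [hx]

theorem integral_mul_test (u : L2 Ω) (φ : 𝓓(Ω, ℝ)) :
    ∫ x in Ω, u x * φ x = inner ℝ u (testLp φ) := by
  rw [L2.inner_def]
  refine integral_congr_ae ?_
  filter_upwards [coeFn_testLp φ] with x hx
  rw [hx]
  simp [mul_comm]

/-- In terms of $L^2$ scalar products with fixed elements, linearity and closedness of the weak
operators are immediate. -/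
theorem hasGrad_iff {u : L2 Ω} {G : L2v Ω} : HasGrad Ω u G ↔
    ∀ Φ : 𝓓(Ω, R3), inner ℝ G (testLp Φ) = -inner ℝ u (testLp (testDiv Φ)) := by
  simp only [HasGrad, ← integral_inner_test, ← integral_mul_test, coe_testDiv]

theorem hasRot_iff {E R : L2v Ω} : HasRot Ω E R ↔
    ∀ Φ : 𝓓(Ω, R3), inner ℝ R (testLp Φ) = inner ℝ E (testLp (testRot Φ)) := by
  simp only [HasRot, ← integral_inner_test, coe_testRot]

theorem hasDiv_iff {E : L2v Ω} {f : L2 Ω} : HasDiv Ω E f ↔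
    ∀ φ : 𝓓(Ω, ℝ), inner ℝ f (testLp φ) = -inner ℝ E (testLp (testGrad φ)) := by
  simp only [HasDiv, ← integral_inner_test, ← integral_mul_test, coe_testGrad]

theorem integral_mul_partial_test (φ ψ : 𝓓(Ω, ℝ)) (j : Fin 3) :
    ∫ x in Ω, φ x * testPartial j ψ x = -∫ x in Ω, testPartial j φ x * ψ x := by
  have hz : ∀ χ : 𝓓(Ω, ℝ), ∀ x, x ∉ (Ω : Set R3) → χ x = 0 := fun χ x hx =>
    image_eq_zero_of_notMem_tsupport fun h => hx (χ.tsupport_subset h)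
  rw [setIntegral_eq_integral_of_forall_compl_eq_zero fun x hx => by rw [hz φ x hx, zero_mul],
    setIntegral_eq_integral_of_forall_compl_eq_zero fun x hx => by rw [hz ψ x hx, mul_zero]]
  have hi : ∀ χ η : 𝓓(Ω, ℝ), Integrable (fun x => χ x * η x) (volume : Measure R3) :=
    fun χ η => (χ.continuous.mul η.continuous).integrable_of_hasCompactSupport
      χ.hasCompactSupport.mul_right
  exact integral_mul_fderiv_eq_neg_fderiv_mul_of_integrable (v := unitVec j)
    (hi (testPartial j φ) ψ) (hi φ (testPartial j ψ)) (hi φ ψ)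
    (fun x _ => φ.contDiff.differentiable (by simp) x)
    (fun x _ => ψ.contDiff.differentiable (by simp) x)

theorem hasGrad_test (φ : 𝓓(Ω, ℝ)) : HasGrad Ω (testLp φ) (testLp (testGrad φ)) := by
  intro Φ
  have hi : ∀ χ η : 𝓓(Ω, ℝ), Integrable (fun x => χ x * η x) (vol Ω) :=
    fun χ η => ((χ.continuous.mul η.continuous).integrable_of_hasCompactSupport
      χ.hasCompactSupport.mul_right).restrict
  have h1 : ∫ x in Ω, inner ℝ (testLp (testGrad φ) x) (Φ x) =
      ∫ x in Ω, ∑ i, testPartial i φ x * testCoord Φ i x := by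
    refine integral_congr_ae ?_
    filter_upwards [coeFn_testLp (testGrad φ)] with x hx
    rw [hx, PiLp.inner_apply]
    exact Finset.sum_congr rfl fun i _ => mul_comm (testCoord Φ i x) (testPartial i φ x)
  have h2 : ∫ x in Ω, testLp φ x * cdiv Φ x =
      ∫ x in Ω, ∑ i, φ x * testPartial i (testCoord Φ i) x := by
    refine integral_congr_ae ?_
    filter_upwards [coeFn_testLp φ] with x hx
    simp only [hx, cdiv, pd_test, Finset.mul_sum]
  rw [h1, h2, integral_finsetSum _ fun i _ => hi _ _, integral_finsetSum _ fun i _ => hi _ _,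
    ← Finset.sum_neg_distrib]
  exact Finset.sum_congr rfl fun i _ => by rw [integral_mul_partial_test, neg_neg]

/-! ## Multiplication by the medium -/

namespace Medium

variable (ε : Medium Ω)

theorem coeFn_mul (E : L2v Ω) :
    ε.mul E =ᵐ[vol Ω] fun x => WithLp.toLp 2 (ε.mat x *ᵥ (E x).ofLp) :=
  MemLp.coeFn_toLp _

/-- Multiplication by the medium as a linear map. -/
noncomputable def mulₗ : L2v Ω →ₗ[ℝ] L2v Ω where
  toFun := ε.mul
  map_add' E F := by
    refine Lp.ext ?_
    filter_upwards [ε.coeFn_mul (E + F), ε.coeFn_mul E, ε.coeFn_mul F, Lp.coeFn_add E F,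
      Lp.coeFn_add (ε.mul E) (ε.mul F)] with x h1 h2 h3 h4 h5
    rw [h5, h1, Pi.add_apply, h2, h3, h4]
    simp [Matrix.mulVec_add]
  map_smul' r E := by
    refine Lp.ext ?_
    filter_upwards [ε.coeFn_mul (r • E), ε.coeFn_mul E, Lp.coeFn_smul r E,
      Lp.coeFn_smul r (ε.mul E)] with x h1 h2 h3 h4
    rw [RingHom.id_apply, h4, h1, Pi.smul_apply, h2, h3]
    simp [Matrix.mulVec_smul]

theorem inner_mul_left (E F : L2v Ω) : inner ℝ (ε.mul E) F = inner ℝ E (ε.mul F) := by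
  rw [L2.inner_def, L2.inner_def]
  refine integral_congr_ae ?_
  filter_upwards [ε.coeFn_mul E, ε.coeFn_mul F, ε.symmetric] with x h1 h2 h3
  rw [h1, h2, EuclideanSpace.inner_eq_star_dotProduct, EuclideanSpace.inner_eq_star_dotProduct]
  simp only [star_trivial]
  rw [← Matrix.vecMul_transpose (ε.mat x), h3.eq, dotProduct_comm, ← Matrix.dotProduct_mulVec,
    dotProduct_comm]

end Medium

/-! ## Functions with vanishing weak gradient -/

/-- The test field $\psi e_j$ has divergence $\partial_j\psi$. -/
theorem HasGrad.integral_mul_partial_eq_zero {v : L2 Ω} (hv : HasGrad Ω v 0) (ψ : 𝓓(Ω, ℝ))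
    (j : Fin 3) : ∫ x in Ω, v x * testPartial j ψ x = 0 := by
  classical
  have hc : ∀ i, testCoord (testField (Pi.single j ψ)) i = (Pi.single j ψ : Fin 3 → 𝓓(Ω, ℝ)) i :=
    fun i => rfl
  have h0 : ∀ i, testPartial i (0 : 𝓓(Ω, ℝ)) = 0 := fun i => by
    rw [← sub_self (0 : 𝓓(Ω, ℝ)), testPartial_sub, sub_self, sub_self]
  have hd : ∀ x, cdiv (testField (Pi.single j ψ)) x = testPartial j ψ x := by
    intro x
    simp only [cdiv, pd_test, hc]
    rw [Finset.sum_eq_single j]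
    · rw [Pi.single_eq_same]
    · intro i _ hi
      rw [Pi.single_eq_of_ne hi, h0]; rfl
    · simp
  have h := hasGrad_iff.1 hv (testField (Pi.single j ψ))
  rw [inner_zero_left, ← integral_mul_test, coe_testDiv] at h
  simp only [hd] at h
  linarith

theorem eq_zero_of_apply_unitVec {f : R3 →L[ℝ] ℝ} (h : ∀ j, f (unitVec j) = 0) : f = 0 := by
  refine ContinuousLinearMap.coe_injective
    ((EuclideanSpace.basisFun (Fin 3) ℝ).toBasis.ext fun j => ?_)
  simpa using h j

/-- The test function `y ↦ ρ (x - y)`. -/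
noncomputable def testShift (ρ : R3 → ℝ) (hρ : ContDiff ℝ (⊤ : ℕ∞) ρ) (x : R3) {r : ℝ}
    (hr : tsupport ρ ⊆ Metric.closedBall 0 r) (hx : Metric.closedBall x r ⊆ Ω) : 𝓓(Ω, ℝ) :=
  have h : tsupport (fun y => ρ (x - y)) ⊆ Metric.closedBall x r :=
    closure_minimal (fun y hy => by
      have := hr (subset_tsupport ρ hy)
      rwa [mem_closedBall_zero_iff, ← dist_eq_norm, dist_comm] at this) Metric.isClosed_closedBall
  { toFun := fun y => ρ (x - y)
    contDiff' := hρ.comp (contDiff_const.sub contDiff_id)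
    hasCompactSupport' := (isCompact_closedBall x r).of_isClosed_subset (isClosed_tsupport _) h
    tsupport_subset' := h.trans hx }

/-- Mollifications of `v` have zero derivative on the ball, hence are constant there, and they
converge to `v` almost everywhere. -/
theorem HasGrad.ae_eq_const_on_ball {v : L2 Ω} (hv : HasGrad Ω v 0) {x₀ : R3} {r : ℝ} (hr : 0 < r)
    (hΩ : Metric.ball x₀ (2 * r) ⊆ Ω) (hb : Bornology.IsBounded (Ω : Set R3)) :
    ∃ c : ℝ, ∀ᵐ x, x ∈ Metric.ball x₀ r → v x = c := by
  set w : R3 → ℝ := (Ω : Set R3).indicator v with hw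
  have hfin : IsFiniteMeasure (vol Ω) := ⟨by simpa using hb.measure_lt_top⟩
  have hwi : LocallyIntegrable w volume :=
    ((integrable_indicator_iff Ω.isOpen.measurableSet).2
      ((Lp.memLp v).integrable (by norm_num))).locallyIntegrable
  -- The outer radius stays below `r`, so a bump centred in the ball of radius `r` is supported in
  -- the ball of radius `2 * r`, hence in `Ω`. The fixed ratio 2 of the radii is what the almost
  -- everywhere convergence requires.
  let φ : ℕ → ContDiffBump (0 : R3) := fun n =>
    { rIn := r / (2 * (n + 2))
      rOut := r / (n + 2)
      rIn_pos := by positivity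
      rIn_lt_rOut := by
        refine div_lt_div_of_pos_left hr (by positivity) ?_
        linarith [(n.cast_nonneg : (0 : ℝ) ≤ n)] }
  have hlt : ∀ n, (φ n).rOut < r := fun n => by
    refine div_lt_self hr ?_
    linarith [(n.cast_nonneg : (0 : ℝ) ≤ n)]
  have hφ0 : Filter.Tendsto (fun n => (φ n).rOut) Filter.atTop (nhds 0) :=
    Filter.Tendsto.div_atTop tendsto_const_nhds
      (Filter.tendsto_atTop_add_const_right _ _ tendsto_natCast_atTop_atTop)
  have hφK : ∀ᶠ n in Filter.atTop, (φ n).rOut ≤ 2 * (φ n).rIn := by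
    refine Filter.Eventually.of_forall fun n => le_of_eq ?_
    simp only [φ]
    field_simp
  have hae := ContDiffBump.ae_convolution_tendsto_right_of_locallyIntegrable (μ := volume)
    hφ0 hφK hwi
  set L : ℝ →L[ℝ] ℝ →L[ℝ] ℝ := ContinuousLinearMap.lsmul ℝ ℝ with hL
  set f : ℕ → R3 → ℝ := fun n => convolution ((φ n).normed volume) w L volume with hf
  have hderiv : ∀ n, ∀ x ∈ Metric.ball x₀ r, HasFDerivAt (f n) (0 : R3 →L[ℝ] ℝ) x := by
    intro n x hx
    have hρ : ContDiff ℝ (⊤ : ℕ∞) ((φ n).normed volume) := (φ n).contDiff_normed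
    have hρc : HasCompactSupport ((φ n).normed volume) := (φ n).hasCompactSupport_normed
    -- The derivative falls on the smooth factor, which has to stand on the right; hence the flipped
    -- bilinear map.
    have h1 := hρc.hasFDerivAt_convolution_right (𝕜 := ℝ) L.flip hwi (hρ.of_le (by simp)) x
    rw [convolution_flip] at h1
    have hlin : ∀ j, (convolution w (fderiv ℝ ((φ n).normed volume)) (L.flip.precompR R3) volume) x
        (unitVec j) = 0 := by
      intro j
      rw [convolution_precompR_apply L.flip hwi (hρc.fderiv ℝ)
        (hρ.continuous_fderiv (by simp))]
      have hsub : Metric.closedBall x (φ n).rOut ⊆ Ω := fun y hy => hΩ (by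
        rw [Metric.mem_ball] at hx ⊢
        rw [Metric.mem_closedBall] at hy
        linarith [dist_triangle y x x₀, hlt n])
      have h2 := hv.integral_mul_partial_eq_zero
        (testShift _ hρ x (by rw [(φ n).tsupport_normed_eq]) hsub) j
      rw [convolution]
      have h3 : ∀ y, testPartial j
          (testShift _ hρ x (by rw [(φ n).tsupport_normed_eq]) hsub) y =
          -fderiv ℝ ((φ n).normed volume) (x - y) (unitVec j) := by
        intro y
        have h4 := ((hρ.differentiable (by simp) (x - y)).hasFDerivAt.comp y
          ((hasFDerivAt_id y).const_sub x)).fderiv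
        change fderiv ℝ ((φ n).normed volume ∘ fun y => x - y) y (unitVec j) = _
        erw [h4]
        simp
      simp only [h3, mul_neg, integral_neg, neg_eq_zero] at h2
      rw [← h2, ← integral_indicator Ω.isOpen.measurableSet]
      refine integral_congr_ae (Filter.Eventually.of_forall fun y => ?_)
      by_cases hy : y ∈ (Ω : Set R3)
      · simp [hw, hL, hy, mul_comm]
      · simp [hw, hL, hy]
    rwa [eq_zero_of_apply_unitVec hlin] at h1
  have hconst : ∀ n, ∀ x ∈ Metric.ball x₀ r, f n x = f n x₀ := by
    intro n x hx
    exact Metric.isOpen_ball.is_const_of_fderiv_eq_zero (convex_ball x₀ r).isPreconnected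
      (fun y hy => (hderiv n y hy).differentiableAt.differentiableWithinAt)
      (fun y hy => (hderiv n y hy).fderiv) hx (Metric.mem_ball_self hr)
  have hsubΩ : Metric.ball x₀ r ⊆ (Ω : Set R3) :=
    (Metric.ball_subset_ball (by linarith)).trans hΩ
  have hlim : ∀ᵐ x, x ∈ Metric.ball x₀ r →
      Filter.Tendsto (fun n => f n x₀) Filter.atTop (nhds (v x)) := by
    filter_upwards [hae] with x hx hxb
    have := hx
    rw [hw, indicator_of_mem (hsubΩ hxb)] at this
    exact this.congr fun n => hconst n x hxb
  -- If the values at the centre have no limit, `hlim` says that almost no point lies in the ball,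
  -- and any constant serves.
  by_cases hex : ∃ c, Filter.Tendsto (fun n => f n x₀) Filter.atTop (nhds c)
  · obtain ⟨c, hc⟩ := hex
    refine ⟨c, ?_⟩
    filter_upwards [hlim] with x hx hxb
    exact tendsto_nhds_unique (hx hxb) hc
  · refine ⟨0, ?_⟩
    filter_upwards [hlim] with x hx hxb
    exact absurd ⟨_, hx hxb⟩ hex

/-- Local constants agree where balls overlap, because a nonempty open intersection has positive
measure. So they form a locally constant function on a connected set. -/
theorem HasGrad.ae_eq_const {v : L2 Ω} (hv : HasGrad Ω v 0) (hc : IsConnected (Ω : Set R3))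
    (hb : Bornology.IsBounded (Ω : Set R3)) : ∃ c : ℝ, ∀ᵐ x ∂(vol Ω), v x = c := by
  have hloc : ∀ x : Ω, ∃ c r : ℝ, 0 < r ∧ ∀ᵐ y, y ∈ Metric.ball (x : R3) r → v y = c := by
    intro x
    obtain ⟨r, hr, hrΩ⟩ := Metric.isOpen_iff.1 Ω.isOpen x x.2
    obtain ⟨c, h⟩ := hv.ae_eq_const_on_ball (x₀ := x) (half_pos hr)
      (by rwa [mul_div_cancel₀ r two_ne_zero]) hb
    exact ⟨c, r / 2, half_pos hr, h⟩
  choose c r hr hcr using hloc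
  have hlc : IsLocallyConstant c := by
    rw [IsLocallyConstant.iff_eventually_eq]
    intro x
    filter_upwards [Metric.ball_mem_nhds x (hr x)] with y hy
    have hne : (Metric.ball (y : R3) (r y) ∩ Metric.ball (x : R3) (r x)).Nonempty :=
      ⟨y, Metric.mem_ball_self (hr y), hy⟩
    have hpos := (Metric.isOpen_ball.inter Metric.isOpen_ball).measure_pos volume hne
    by_contra hcne
    refine hpos.ne' (measure_mono_null ?_ ((hcr x).and (hcr y)))
    rintro z ⟨hzy, hzx⟩ h
    exact hcne ((h.2 hzy).symm.trans (h.1 hzx))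
  have : PreconnectedSpace Ω := isPreconnected_iff_preconnectedSpace.1 hc.isPreconnected
  obtain ⟨x₁, hx₁⟩ := hc.nonempty
  refine ⟨c ⟨x₁, hx₁⟩, ?_⟩
  rw [ae_restrict_iff' Ω.isOpen.measurableSet, ae_iff]
  -- The exceptional set is null near each of its points, which suffices by second countability.
  refine measure_null_of_locally_null _ fun x hx => ?_
  have hxΩ : x ∈ Ω := by
    by_contra h
    exact hx fun h' => absurd h' h
  refine ⟨_, inter_mem_nhdsWithin _ (Metric.ball_mem_nhds x (hr ⟨x, hxΩ⟩)), ?_⟩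
  refine measure_mono_null ?_ (hcr ⟨x, hxΩ⟩)
  rintro z ⟨hz, hzb⟩ h
  refine hz fun _ => ?_
  rw [h hzb]
  exact hlc.apply_eq_of_preconnectedSpace _ _

/-- A function of vanishing mean is orthogonal to every function of vanishing gradient. -/
theorem HasGrad.inner_eq_zero {v : L2 Ω} (hv : HasGrad Ω v 0) (hc : IsConnected (Ω : Set R3))
    (hb : Bornology.IsBounded (Ω : Set R3)) {u : L2 Ω} (hu : ∫ x in Ω, u x = 0) :
    inner ℝ v u = 0 := by
  obtain ⟨c, h⟩ := hv.ae_eq_const hc hb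
  rw [L2.inner_def]
  have : ∫ x in Ω, inner ℝ (v x) (u x) = ∫ x in Ω, c * u x := by
    refine integral_congr_ae ?_
    filter_upwards [h] with x hx
    rw [hx]
    simp [mul_comm]
  rw [this, integral_const_mul, hu, mul_zero]

/-- The Friedrichs inequality for test functions on a bounded open set. -/
theorem exists_norm_test_le (hb : Bornology.IsBounded (Ω : Set R3)) :
    ∃ C : ℝ, ∀ φ : 𝓓(Ω, ℝ), ‖testLp φ‖ ≤ C * ‖testLp (testGrad φ)‖ := by
  refine ⟨(eLpNormLESNormFDerivOfLeConst ℝ (volume : Measure R3) (Ω : Set R3) 2 2 : ℝ≥0), ?_⟩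
  intro φ
  -- The Sobolev inequality on functions supported in a bounded set, with equal exponents 2, below
  -- the dimension 3.
  have h := eLpNorm_le_eLpNorm_fderiv (volume : Measure R3) (u := φ) (s := (Ω : Set R3)) (p := 2)
    (φ.contDiff.of_le (by simp)) ((subset_tsupport φ).trans φ.tsupport_subset)
    (by norm_num) (by simp; norm_num) hb
  have hn : ∀ x, ‖fderiv ℝ φ x‖ = ‖testGrad φ x‖ := fun x => by
    rw [coe_testGrad]
    exact ((InnerProductSpace.toDual ℝ R3).symm.norm_map _).symm
  have hr : ∀ {F : Type} [NormedAddCommGroup F] [NormedSpace ℝ F] (ψ : 𝓓(Ω, F)),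
      eLpNorm ψ 2 (vol Ω) = eLpNorm ψ 2 volume := fun ψ => by
    rw [← eLpNorm_indicator_eq_eLpNorm_restrict Ω.isOpen.measurableSet,
      indicator_eq_self.2 ((subset_tsupport ψ).trans ψ.tsupport_subset)]
  rw [eLpNorm_congr_norm_ae (Filter.Eventually.of_forall hn)] at h
  have h' : eLpNorm φ 2 (vol Ω) ≤
      eLpNormLESNormFDerivOfLeConst ℝ (volume : Measure R3) (Ω : Set R3) 2 2 * eLpNorm (testGrad φ) 2 (vol Ω) := by
    rw [hr, hr]; exact h
  rw [testLp, testLp, Lp.norm_toLp, Lp.norm_toLp, ← ENNReal.coe_toReal, ← ENNReal.toReal_mul]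
  exact ENNReal.toReal_mono (ENNReal.mul_ne_top (by simp) (memLp_test _).2.ne) h'

/-- The Friedrichs inequality is a closed condition on pairs, so it passes from test functions to
their closure. -/
theorem HasGrad₀.eq_zero {v : L2 Ω} (hb : Bornology.IsBounded (Ω : Set R3))
    (hv : HasGrad₀ Ω v 0) : v = 0 := by
  obtain ⟨C, hC⟩ := exists_norm_test_le hb
  have hcl : IsClosed {p : L2 Ω × L2v Ω | ‖p.1‖ ≤ C * ‖p.2‖} :=
    isClosed_le continuous_fst.norm (continuous_const.mul continuous_snd.norm)
  have hsub : {p : L2 Ω × L2v Ω | ∃ φ : 𝓓(Ω, ℝ), p.1 =ᵐ[vol Ω] φ ∧ p.2 =ᵐ[vol Ω] gradient φ} ⊆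
      {p : L2 Ω × L2v Ω | ‖p.1‖ ≤ C * ‖p.2‖} := by
    rintro p ⟨φ, h1, h2⟩
    rw [← coe_testGrad] at h2
    change ‖p.1‖ ≤ C * ‖p.2‖
    rw [eq_testLp h1, eq_testLp h2]
    exact hC φ
  have h := closure_minimal hsub hcl hv.2
  rwa [mem_ofPred_eq, norm_zero, mul_zero, norm_le_zero_iff] at h

/-! ## The operators on test functions as linear relations -/

theorem testPartial_add (j : Fin 3) (φ ψ : 𝓓(Ω, ℝ)) :
    testPartial j (φ + ψ) = testPartial j φ + testPartial j ψ := by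
  have h := testPartial_sub j (φ + ψ) ψ
  rw [add_sub_cancel_right] at h
  rw [h, sub_add_cancel]

theorem testPartial_smul (j : Fin 3) (r : ℝ) (φ : 𝓓(Ω, ℝ)) :
    testPartial j (r • φ) = r • testPartial j φ := by
  ext x
  change partialD j (fun y => r • φ y) x = r • partialD j φ x
  have h := fderiv_fun_const_smul (𝕜 := ℝ) (f := φ) (x := x)
    (φ.contDiff.differentiable (by simp) x) r
  simp only [partialD, h]
  rfl

/-- Test functions as square integrable functions, as a linear map. -/
noncomputable def testLpₗ (Ω : TopologicalSpace.Opens R3) (F : Type*) [NormedAddCommGroup F]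
    [NormedSpace ℝ F] : 𝓓(Ω, F) →ₗ[ℝ] Lp F 2 (vol Ω) where
  toFun := testLp
  map_add' φ ψ := (memLp_test φ).toLp_add (memLp_test ψ)
  map_smul' r φ := (memLp_test φ).toLp_const_smul r

/-- The gradient of test functions, as a linear map. -/
noncomputable def testGradₗ (Ω : TopologicalSpace.Opens R3) : 𝓓(Ω, ℝ) →ₗ[ℝ] 𝓓(Ω, R3) where
  toFun := testGrad
  map_add' φ ψ := by
    ext x i
    exact DFunLike.congr_fun (testPartial_add i φ ψ) x
  map_smul' r φ := by
    ext x i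
    exact DFunLike.congr_fun (testPartial_smul i r φ) x

/-- The divergence of test fields, as a linear map. -/
noncomputable def testDivₗ (Ω : TopologicalSpace.Opens R3) : 𝓓(Ω, R3) →ₗ[ℝ] 𝓓(Ω, ℝ) where
  toFun := testDiv
  map_add' Φ Ψ := by
    have h : ∀ i, testCoord (Φ + Ψ) i = testCoord Φ i + testCoord Ψ i := fun i => rfl
    simp only [testDiv, h, testPartial_add]
    abel
  map_smul' r Φ := by
    have h : ∀ i, testCoord (r • Φ) i = r • testCoord Φ i := fun i => rfl
    simp only [testDiv, h, testPartial_smul, smul_add, RingHom.id_apply]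

/-- The gradient of test functions as a linear relation. -/
noncomputable def gradTestRel (Ω : TopologicalSpace.Opens R3) : Submodule ℝ (L2 Ω × L2v Ω) :=
  LinearMap.range ((testLpₗ Ω ℝ).prod ((testLpₗ Ω R3).comp (testGradₗ Ω)))

/-- The divergence of test fields as a linear relation. -/
noncomputable def divTestRel (Ω : TopologicalSpace.Opens R3) : Submodule ℝ (L2v Ω × L2 Ω) :=
  LinearMap.range ((testLpₗ Ω R3).prod ((testLpₗ Ω ℝ).comp (testDivₗ Ω)))

theorem mem_gradTestRel {p : L2 Ω × L2v Ω} :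
    p ∈ gradTestRel Ω ↔ ∃ φ : 𝓓(Ω, ℝ), (testLp φ, testLp (testGrad φ)) = p :=
  LinearMap.mem_range

theorem mem_divTestRel {p : L2v Ω × L2 Ω} :
    p ∈ divTestRel Ω ↔ ∃ Φ : 𝓓(Ω, R3), (testLp Φ, testLp (testDiv Φ)) = p :=
  LinearMap.mem_range

theorem setOf_gradient_eq (Ω : TopologicalSpace.Opens R3) : {p : L2 Ω × L2v Ω |
    ∃ φ : 𝓓(Ω, ℝ), p.1 =ᵐ[vol Ω] φ ∧ p.2 =ᵐ[vol Ω] gradient φ} = gradTestRel Ω := by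
  ext p
  rw [mem_ofPred_eq, SetLike.mem_coe, mem_gradTestRel]
  constructor
  · rintro ⟨φ, h1, h2⟩
    rw [← coe_testGrad] at h2
    exact ⟨φ, Prod.ext (eq_testLp h1).symm (eq_testLp h2).symm⟩
  · rintro ⟨φ, rfl⟩
    refine ⟨φ, coeFn_testLp φ, ?_⟩
    rw [← coe_testGrad]
    exact coeFn_testLp (testGrad φ)

theorem setOf_cdiv_eq (Ω : TopologicalSpace.Opens R3) : {p : L2v Ω × L2 Ω |
    ∃ Φ : 𝓓(Ω, R3), p.1 =ᵐ[vol Ω] Φ ∧ p.2 =ᵐ[vol Ω] cdiv Φ} = divTestRel Ω := by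
  ext p
  rw [mem_ofPred_eq, SetLike.mem_coe, mem_divTestRel]
  constructor
  · rintro ⟨φ, h1, h2⟩
    rw [← coe_testDiv] at h2
    exact ⟨φ, Prod.ext (eq_testLp h1).symm (eq_testLp h2).symm⟩
  · rintro ⟨φ, rfl⟩
    refine ⟨φ, coeFn_testLp φ, ?_⟩
    rw [← coe_testDiv]
    exact coeFn_testLp (testDiv φ)

/-- The weak gradient as a linear relation. -/
noncomputable def gradRel (Ω : TopologicalSpace.Opens R3) : Submodule ℝ (L2 Ω × L2v Ω) where
  carrier := {p | HasGrad Ω p.1 p.2}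
  add_mem' := by
    intro p q hp hq
    rw [mem_ofPred_eq, hasGrad_iff] at *
    intro Φ
    rw [Prod.fst_add, Prod.snd_add, inner_add_left, inner_add_left, hp, hq]
    ring
  zero_mem' := by
    rw [mem_ofPred_eq, hasGrad_iff]
    intro Φ
    simp
  smul_mem' := by
    intro r p hp
    rw [mem_ofPred_eq, hasGrad_iff] at *
    intro Φ
    rw [Prod.smul_fst, Prod.smul_snd, real_inner_smul_left, real_inner_smul_left, hp]
    ring

theorem mem_gradRel {p : L2 Ω × L2v Ω} : p ∈ gradRel Ω ↔ HasGrad Ω p.1 p.2 := Iff.rfl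

theorem isClosed_gradRel (Ω : TopologicalSpace.Opens R3) :
    IsClosed (gradRel Ω : Set (L2 Ω × L2v Ω)) := by
  have h : (gradRel Ω : Set (L2 Ω × L2v Ω)) = ⋂ Φ : 𝓓(Ω, R3),
      {p | inner ℝ p.2 (testLp Φ) = -inner ℝ p.1 (testLp (testDiv Φ))} := by
    ext p
    rw [SetLike.mem_coe, mem_gradRel, hasGrad_iff, mem_iInter]
    exact Iff.rfl
  rw [h]
  exact isClosed_iInter fun Φ => isClosed_eq (continuous_snd.inner continuous_const)
    (continuous_fst.inner continuous_const).neg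

theorem gradTestRel_le : gradTestRel Ω ≤ gradRel Ω := by
  intro p hp
  obtain ⟨φ, rfl⟩ := mem_gradTestRel.1 hp
  exact hasGrad_test φ

/-- The weak gradient condition is automatic on the closure, since the weak gradient is a closed
relation containing the test gradients. -/
theorem hasGrad₀_iff {u : L2 Ω} {G : L2v Ω} :
    HasGrad₀ Ω u G ↔ (u, G) ∈ (gradTestRel Ω).topologicalClosure := by
  rw [HasGrad₀, setOf_gradient_eq]
  refine ⟨fun h => h.2, fun h => ⟨?_, h⟩⟩
  exact (gradTestRel Ω).topologicalClosure_minimal gradTestRel_le (isClosed_gradRel Ω) h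

theorem hasGrad₀_test (φ : 𝓓(Ω, ℝ)) : HasGrad₀ Ω (testLp φ) (testLp (testGrad φ)) :=
  hasGrad₀_iff.2 (Submodule.le_topologicalClosure _ (mem_gradTestRel.2 ⟨φ, rfl⟩))

/-- The divergence with boundary condition is the adjoint of the gradient. -/
theorem hasDiv₀_of_forall {F : L2v Ω} {f : L2 Ω}
    (h : ∀ p ∈ gradRel Ω, inner ℝ F p.2 = -inner ℝ f p.1) : HasDiv₀ Ω F f := by
  refine ⟨hasDiv_iff.2 fun φ => ?_, ?_⟩
  · linarith [h _ (gradTestRel_le (mem_gradTestRel.2 ⟨φ, rfl⟩))]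
  · rw [setOf_cdiv_eq]
    -- A pair `(G, u)` annihilating all test pairs $(\Phi,\mathrm{div}\,\Phi)$ satisfies exactly the
    -- definition of $\nabla u=G$, so `h` applies to it.
    refine Submodule.mem_closure_prod_of_forall_orthogonal _ _ fun G u hGu => ?_
    have hm : (u, G) ∈ gradRel Ω := by
      refine hasGrad_iff.2 fun Φ => ?_
      have := hGu _ (mem_divTestRel.2 ⟨Φ, rfl⟩)
      linarith
    have := h _ hm
    simp only at this ⊢
    rw [real_inner_comm F G, real_inner_comm f u]
    linarith

theorem HasDiv₀.inner_eq {F : L2v Ω} {f : L2 Ω} (h : HasDiv₀ Ω F f) {u : L2 Ω} {G : L2v Ω}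
    (hG : HasGrad Ω u G) : inner ℝ F G = -inner ℝ f u := by
  have h2 := h.2
  rw [setOf_cdiv_eq] at h2
  have hcl : IsClosed {p : L2v Ω × L2 Ω | inner ℝ p.1 G = -inner ℝ p.2 u} :=
    isClosed_eq (continuous_fst.inner continuous_const)
      (continuous_snd.inner continuous_const).neg
  have hsub : (divTestRel Ω : Set (L2v Ω × L2 Ω)) ⊆ {p | inner ℝ p.1 G = -inner ℝ p.2 u} := by
    intro p hp
    obtain ⟨Φ, rfl⟩ := mem_divTestRel.1 hp
    have := hasGrad_iff.1 hG Φ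
    rw [real_inner_comm, real_inner_comm (testLp (testDiv Φ)) u] at this
    exact this
  have := closure_minimal hsub hcl h2
  rwa [mem_ofPred_eq] at this

/-- For test functions this is the definition of the weak divergence, and both sides are continuous
in `(u, G)`. -/
theorem HasDiv.inner_eq {F : L2v Ω} {f : L2 Ω} (h : HasDiv Ω F f) {u : L2 Ω} {G : L2v Ω}
    (hG : HasGrad₀ Ω u G) : inner ℝ F G = -inner ℝ f u := by
  have h2 := hG.2
  rw [setOf_gradient_eq] at h2
  have hcl : IsClosed {p : L2 Ω × L2v Ω | inner ℝ F p.2 = -inner ℝ f p.1} :=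
    isClosed_eq (continuous_const.inner continuous_snd)
      (continuous_const.inner continuous_fst).neg
  have hsub : (gradTestRel Ω : Set (L2 Ω × L2v Ω)) ⊆ {p | inner ℝ F p.2 = -inner ℝ f p.1} := by
    intro p hp
    obtain ⟨φ, rfl⟩ := mem_gradTestRel.1 hp
    have := hasDiv_iff.1 h φ
    exact (neg_eq_iff_eq_neg.2 this).symm
  have := closure_minimal hsub hcl h2
  rwa [mem_ofPred_eq] at this

/-! ## Limits of gradients are rotation-free -/

/-- The closure of the range of a gradient relation. -/
noncomputable abbrev rangeClosure (Γ : Submodule ℝ (L2 Ω × L2v Ω)) : Submodule ℝ (L2v Ω) :=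
  (Γ.map (LinearMap.snd ℝ (L2 Ω) (L2v Ω))).topologicalClosure

theorem mem_of_mem_rangeClosure {Γ : Submodule ℝ (L2 Ω × L2v Ω)} {S : Set (L2v Ω)}
    (hS : IsClosed S) (h : ∀ p ∈ Γ, p.2 ∈ S) {E : L2v Ω} (hE : E ∈ rangeClosure Γ) : E ∈ S := by
  refine closure_minimal ?_ hS hE
  rintro _ ⟨p, hp, rfl⟩
  exact h p hp

theorem inner_eq_zero_of_mem_rangeClosure {Γ : Submodule ℝ (L2 Ω × L2v Ω)} {F : L2v Ω}
    (h : ∀ p ∈ Γ, inner ℝ F p.2 = 0) {E : L2v Ω} (hE : E ∈ rangeClosure Γ) :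
    inner ℝ F E = 0 := by
  have hS : IsClosed {E : L2v Ω | inner ℝ F E = 0} :=
    isClosed_eq (continuous_const.inner continuous_id) continuous_const
  have := mem_of_mem_rangeClosure hS h hE
  rwa [mem_ofPred_eq] at this

theorem hasRot_zero_of_mem_rangeClosure {E : L2v Ω} (hE : E ∈ rangeClosure (gradRel Ω)) :
    HasRot Ω E 0 := by
  refine hasRot_iff.2 fun Φ => ?_
  rw [inner_zero_left, real_inner_comm]
  refine (inner_eq_zero_of_mem_rangeClosure (fun p hp => ?_) hE).symm
  have h0 : testLp (testDiv (testRot Φ)) = 0 := by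
    have : testDiv (testRot Φ) = 0 := by
      refine DFunLike.coe_injective ?_
      rw [coe_testDiv, coe_testRot, cdiv_crot]
      rfl
    rw [this]
    exact (testLpₗ Ω ℝ).map_zero
  rw [real_inner_comm, hasGrad_iff.1 hp, h0, inner_zero_right, neg_zero]

theorem hasRot₀_zero_of_mem_rangeClosure {E : L2v Ω}
    (hE : E ∈ rangeClosure (gradTestRel Ω).topologicalClosure) : HasRot₀ Ω E 0 := by
  have hle : (gradTestRel Ω).topologicalClosure ≤ gradRel Ω :=
    (gradTestRel Ω).topologicalClosure_minimal gradTestRel_le (isClosed_gradRel Ω)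
  refine ⟨hasRot_zero_of_mem_rangeClosure
    (Submodule.topologicalClosure_mono (Submodule.map_mono hle) hE), ?_⟩
  set T := {p : L2v Ω × L2v Ω | ∃ Φ : 𝓓(Ω, R3), p.1 =ᵐ[vol Ω] Φ ∧ p.2 =ᵐ[vol Ω] crot Φ} with hT
  -- Two closures are removed in turn: that of the range, then that of the relation. What is left
  -- are test gradients, which are test fields without rotation.
  have hcl : IsClosed ((fun E : L2v Ω => (E, (0 : L2v Ω))) ⁻¹' closure T) :=
    isClosed_closure.preimage (continuous_id.prodMk continuous_const)
  refine mem_of_mem_rangeClosure hcl (fun p hp => ?_) hE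
  have hcl' : IsClosed ((fun p : L2 Ω × L2v Ω => (p.2, (0 : L2v Ω))) ⁻¹' closure T) :=
    isClosed_closure.preimage (continuous_snd.prodMk continuous_const)
  refine closure_minimal (?_ : (gradTestRel Ω : Set (L2 Ω × L2v Ω)) ⊆ _) hcl' hp
  intro q hq
  obtain ⟨φ, rfl⟩ := mem_gradTestRel.1 hq
  refine subset_closure ⟨testGrad φ, coeFn_testLp (testGrad φ), ?_⟩
  rw [coe_testGrad, crot_gradient]
  exact Lp.coeFn_zero _ _ _

/-! ## The estimates -/

namespace Medium

variable (ε : Medium Ω)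

/-- Cauchy–Schwarz for the form of $\varepsilon$, applied to $E$ and $\varepsilon E$, turns the
bound on the quadratic form into $\|\varepsilon E\|\le\overline\varepsilon^2\|E\|$. -/
theorem exists_mulL {hi : ℝ}
    (h0 : ∀ E : L2v Ω, 0 ≤ inner ℝ (ε.mul E) E)
    (hε : ∀ E : L2v Ω, inner ℝ (ε.mul E) E ≤ hi ^ 2 * ‖E‖ ^ 2) :
    ∃ M : L2v Ω →L[ℝ] L2v Ω, ∀ E, M E = ε.mul E := by
  refine ⟨ε.mulₗ.mkContinuous (hi ^ 2) fun E => ?_, fun E => rfl⟩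
  have h := abs_inner_le_sqrt_mul_sqrt ε.mulₗ ε.inner_mul_left h0 E (ε.mul E)
  have hs : ∀ F : L2v Ω, √(inner ℝ (ε.mulₗ F) F) ≤ |hi| * ‖F‖ := fun F => by
    rw [← Real.sqrt_sq (mul_nonneg (abs_nonneg hi) (norm_nonneg F)), mul_pow, sq_abs]
    exact Real.sqrt_le_sqrt (hε F)
  have h1 : ‖ε.mul E‖ ^ 2 ≤ (|hi| * ‖E‖) * (|hi| * ‖ε.mul E‖) := by
    rw [← real_inner_self_eq_norm_sq]
    exact ((le_abs_self _).trans h).trans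
      (mul_le_mul (hs _) (hs _) (Real.sqrt_nonneg _) (by positivity))
  change ‖ε.mul E‖ ≤ _
  rcases (norm_nonneg (ε.mul E)).eq_or_lt with h2 | h2
  · rw [← h2]; positivity
  · refine le_of_mul_le_mul_right ?_ h2
    calc ‖ε.mul E‖ * ‖ε.mul E‖ = ‖ε.mul E‖ ^ 2 := (sq _).symm
      _ ≤ _ := h1
      _ = |hi| ^ 2 * ‖E‖ * ‖ε.mul E‖ := by ring
      _ = hi ^ 2 * ‖E‖ * ‖ε.mul E‖ := by rw [sq_abs]

variable {ε} {lo hi : ℝ}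

/-- The abstract estimate for a closed gradient relation. -/
theorem norm_le_of_gradient_estimate (hlo : 0 < lo) (hhi : 0 < hi)
    (hε : ∀ E : L2v Ω,
      lo⁻¹ ^ 2 * ‖E‖ ^ 2 ≤ inner ℝ (ε.mul E) E ∧ inner ℝ (ε.mul E) E ≤ hi ^ 2 * ‖E‖ ^ 2)
    {Γ : Submodule ℝ (L2 Ω × L2v Ω)} (hΓ : IsClosed (Γ : Set (L2 Ω × L2v Ω))) {c : ℝ} (hc : 0 ≤ c)
    (hest : ∀ E ∈ rangeClosure Γ, ∀ f : L2 Ω,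
      (∀ p ∈ Γ, inner ℝ (ε.mul E) p.2 = -inner ℝ f p.1) → ε.wnorm E ≤ c * ‖f‖)
    {u : L2 Ω} {G : L2v Ω} (hu : (u, G) ∈ Γ)
    (hker : ∀ v, (v, (0 : L2v Ω)) ∈ Γ → inner ℝ v u = 0) :
    ‖u‖ ≤ c * (lo * hi ^ 2) * ‖G‖ := by
  have h0 : ∀ E : L2v Ω, 0 ≤ inner ℝ (ε.mul E) E :=
    fun E => le_trans (by positivity) (hε E).1
  obtain ⟨M, hM⟩ := ε.exists_mulL h0 fun E => (hε E).2
  have h := norm_le_of_adjoint_estimate M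
    (fun E F => by rw [hM, hM]; exact ε.inner_mul_left E F)
    (α := lo⁻¹ ^ 2) (by positivity) (fun E => by rw [hM]; exact (hε E).1) hhi.le
    (fun E => by rw [hM]; exact (hε E).2) Γ hΓ hc
    (fun E hE f hf => by
      rw [hM]
      exact hest E hE f fun p hp => by rw [← hM]; exact hf p hp) hu hker
  -- The duality yields the factor `c * hi`. Weakening it to `c * (lo * hi ^ 2)` needs `1 ≤ lo *
  -- hi`, which is read off from the two bounds on $\varepsilon$ at a nonzero field.
  rcases (norm_nonneg G).eq_or_lt with hG | hG
  · rw [← hG, mul_zero] at h ⊢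
    exact h
  · have h1 : 1 ≤ lo * hi := by
      have h2 := (hε G).1.trans (hε G).2
      have h3 : lo⁻¹ ^ 2 ≤ hi ^ 2 := le_of_mul_le_mul_right h2 (by positivity)
      have h4 : lo⁻¹ ≤ hi := le_of_sq_le_sq h3 hhi.le
      calc (1 : ℝ) = lo * lo⁻¹ := (mul_inv_cancel₀ hlo.ne').symm
        _ ≤ lo * hi := by gcongr
    refine h.trans ?_
    have : hi ≤ lo * hi ^ 2 := by nlinarith
    gcongr

theorem isProj_zero {K : L2v Ω → Prop} {E : L2v Ω} (h0 : K 0)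
    (h : ∀ W, K W → inner ℝ (ε.mul W) E = 0) : ε.IsProj K E 0 := by
  refine ⟨h0, fun W hW => ?_⟩
  rw [sub_zero, scp, ε.inner_mul_left, real_inner_comm]
  exact h W hW

theorem mul_zero_field : ε.mul 0 = 0 := ε.mulₗ.map_zero

theorem isDirichletField_zero : ε.IsDirichletField 0 := by
  refine ⟨hasRot₀_zero_of_mem_rangeClosure (Submodule.zero_mem _), ?_⟩
  rw [mul_zero_field]
  exact hasDiv_iff.2 fun φ => by simp

theorem isNeumannField_zero : ε.IsNeumannField 0 := by
  refine ⟨hasRot_zero_of_mem_rangeClosure (Submodule.zero_mem _), ?_⟩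
  rw [mul_zero_field]
  exact hasDiv₀_of_forall fun p _ => by simp

end Medium

theorem div_le_sInf_of_forall_mul_le {S : ℝ≥0∞} {P : ℝ≥0 → Prop} {k : ℝ}
    (h : ∀ c : ℝ≥0, P c → S ≤ (c * k.toNNReal : ℝ≥0)) :
    S / ENNReal.ofReal k ≤ sInf {c : ℝ≥0∞ | ∃ c' : ℝ≥0, c = c' ∧ P c'} := by
  refine le_sInf ?_
  rintro _ ⟨c, rfl, hc⟩
  refine ENNReal.div_le_of_le_mul ?_
  rw [ENNReal.ofReal, ← ENNReal.coe_mul]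
  exact h c hc

end Maxwell

open Maxwell in
theorem theorem3p5 (Ω : TopologicalSpace.Opens Maxwell.R3)
    (hΩ : Maxwell.IsBoundedLipschitzDomain Ω) (ε : Maxwell.Medium Ω)
    (lo hi : ℝ) (hlo : 0 < lo) (hhi : 0 < hi)
    (hε : ∀ E : Maxwell.L2v Ω,
      lo⁻¹ ^ 2 * ‖E‖ ^ 2 ≤ inner ℝ (ε.mul E) E ∧ inner ℝ (ε.mul E) E ≤ hi ^ 2 * ‖E‖ ^ 2) :
    Maxwell.poincareConstDirichlet Ω / ENNReal.ofReal (lo * hi ^ 2)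
        ≤ Maxwell.maxwellConstTangential ε ∧
      Maxwell.poincareConst Ω / ENNReal.ofReal (lo * hi ^ 2)
        ≤ Maxwell.maxwellConstNormal ε := by
  have hk : 0 < lo * hi ^ 2 := by positivity
  constructor
  · refine div_le_sInf_of_forall_mul_le fun c hc => sInf_le ⟨_, rfl, fun u G hu => ?_⟩
    rw [NNReal.coe_mul, Real.coe_toNNReal _ hk.le]
    refine Medium.norm_le_of_gradient_estimate hlo hhi hε
      (gradTestRel Ω).isClosed_topologicalClosure c.2 (fun E hE f hf => ?_)
      (hasGrad₀_iff.1 hu) (fun v hv => ?_)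
    · have h := hc E 0 0 f (hasRot₀_zero_of_mem_rangeClosure hE)
        (hasDiv_iff.2 fun φ => by
          have := hf _ (hasGrad₀_iff.1 (hasGrad₀_test φ))
          simp only at this
          linarith)
        (Medium.isProj_zero Medium.isDirichletField_zero fun W hW =>
          inner_eq_zero_of_mem_rangeClosure
            (fun p hp => by rw [hW.2.inner_eq (hasGrad₀_iff.2 hp), inner_zero_left, neg_zero]) hE)
      simpa [Real.sqrt_sq] using h
    · rw [(hasGrad₀_iff.2 hv).eq_zero hΩ.bounded, inner_zero_left]
  · refine div_le_sInf_of_forall_mul_le fun c hc => sInf_le ⟨_, rfl, fun u G hu hu0 => ?_⟩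
    rw [NNReal.coe_mul, Real.coe_toNNReal _ hk.le]
    refine Medium.norm_le_of_gradient_estimate hlo hhi hε
      (isClosed_gradRel Ω) c.2 (fun E hE f hf => ?_)
      (mem_gradRel.2 hu) (fun v hv => ?_)
    · have h := hc E 0 0 f (hasRot_zero_of_mem_rangeClosure hE) (hasDiv₀_of_forall hf)
        (Medium.isProj_zero Medium.isNeumannField_zero fun W hW =>
          inner_eq_zero_of_mem_rangeClosure
            (fun p hp => by rw [hW.2.inner_eq (mem_gradRel.1 hp), inner_zero_left, neg_zero]) hE)
      simpa [Real.sqrt_sq] using h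
    · exact (mem_gradRel.1 hv).inner_eq_zero hΩ.connected hΩ.bounded hu0
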